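/- Let $\langle T,\sqsubseteq\rangle$ be a tree, i.e. a partially ordered set in which the set $x{\downarrow}=\{y : y\sqsubset x\}$ is well-ordered for every $x\in T$. The height of $x$ is the order type of $x{\downarrow}$, $T_\alpha$ is the set of elements of height $\alpha$, and the height of $T$ is the least $\beta$ with $T_\beta=\emptyset$. Assume that $T$ is a Souslin tree: its height is $\omega_1$, all its levels are countable, and it has no uncountable chains and no uncountable antichains (sets of pairwise incomparable elements). Assume also that $T$ is normal; with $\kappa=\omega_1$ its height, this means that (i) $|T_0|=1$; (ii) if $\alpha+1<\kappa$, every $x\in T_\alpha$ has at least two distinct elements of $T_{\alpha+1}$ above it; (iii) if $\alpha<\beta<\kappa$, every $x\in T_\alpha$ has an element of $T_\beta$ above it; (iv) if $\alpha<\kappa$ is a limit ordinal and $x,y\in T_\alpha$ satisfy $x{\downarrow}=y{\downarrow}$, then $x=y$. Let $\prec$ be any strict total order on $T$ (for instance, a well-order). Let $\le$ be the lexicographic linear order on $T$ determined by $\prec$: $s\le t$ if and only if either $s\sqsubseteq t$, or $s$ and $t$ are $\sqsubseteq$-incomparable and $a\prec b$, where $m$ is the greatest element of $s{\downarrow}\cap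 t{\downarrow}$ and $a\sqsubseteq s$, $b\sqsubseteq t$ are the immediate successors of $m$ below (or equal to) $s$ and $t$, respectively. Then $T$ with the order topology of $\le$ is functionally countable, that is, every continuous function $T\to\mathbb{R}$ has countable image. It is moreover exponentially separable: for every countable family $\mathcal F$ of closed sets there is a countable set $A$ such that $A\cap\bigcap\mathcal G\ne\emptyset$ for every $\mathcal G\subseteq\mathcal F$ with $\bigcap\mathcal G\neq\emptyset$. -/

import Mathlib

open Set Ordinal

universe u

/-! ### Set-theoretic trees -/

/-- A tree: a partial order in which the set of predecessors of every element is well-ordered. -/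
class IsOrderTree (T : Type u) [PartialOrder T] : Prop where
  isWellOrder_Iio : ∀ x : T, IsWellOrder (Iio x) (fun a b => a < b)

attribute [instance] IsOrderTree.isWellOrder_Iio

section Trees

variable (T : Type u) [PartialOrder T] [IsOrderTree T]

/-- The height of an element: the order type of its set of strict predecessors. -/
noncomputable def nodeHeight {T : Type u} [PartialOrder T] [IsOrderTree T] (x : T) : Ordinal.{u} :=
  Ordinal.type (fun a b : Iio x => a < b)

/-- The `α`-th level of the tree. -/
def treeLevel (α : Ordinal.{u}) : Set T := {x | nodeHeight x = α}

/-- The height of the tree: the least `β` such that the `β`-th level is empty. -/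
noncomputable def treeHeight : Ordinal.{u} := sInf {β | treeLevel T β = ∅}

/-- A Souslin tree: a tree of height `ω₁` with countable levels, without uncountable chains and
without uncountable antichains (sets of pairwise incomparable elements). -/
structure IsSouslinTree : Prop where
  height_eq : treeHeight T = ω₁
  countable_level : ∀ α, (treeLevel T α).Countable
  countable_chain : ∀ C : Set T, IsChain (· ≤ ·) C → C.Countable
  countable_antichain : ∀ A : Set T, IsAntichain (· ≤ ·) A → A.Countable

/-- A normal tree: rooted, splitting, pruned and Hausdorff. -/
class IsNormalTree : Prop where
  rooted : ∃! x : T, x ∈ treeLevel T 0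
  splitting : ∀ α, α + 1 < treeHeight T → ∀ x ∈ treeLevel T α,
    ∃ y₀ ∈ treeLevel T (α + 1), ∃ y₁ ∈ treeLevel T (α + 1), x < y₀ ∧ x < y₁ ∧ y₀ ≠ y₁
  pruned : ∀ α β, α < β → β < treeHeight T → ∀ x ∈ treeLevel T α,
    ∃ y ∈ treeLevel T β, x < y
  hausdorff : ∀ α, α < treeHeight T → Order.IsSuccLimit α →
    ∀ x ∈ treeLevel T α, ∀ y ∈ treeLevel T α, Iio x = Iio y → x = y

end Trees

/-! ### The lexicographic order -/

section Lex

variable {T : Type u} [PartialOrder T]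

/-- `s` and `t` are incomparable and, `m` being the greatest common strict predecessor of `s` and
`t`, the immediate successor `a` of `m` below `s` is `r`-smaller than the immediate successor `b`
of `m` below `t`. -/
def BranchLT (r : T → T → Prop) (s t : T) : Prop :=
  ¬ s ≤ t ∧ ¬ t ≤ s ∧ ∃ m a b : T, IsGreatest (Iio s ∩ Iio t) m ∧
    m ⋖ a ∧ a ≤ s ∧ m ⋖ b ∧ b ≤ t ∧ r a b

/-- The lexicographic order of a tree, with respect to a strict order `r` on its nodes. -/
def LexLE (r : T → T → Prop) (s t : T) : Prop := s ≤ t ∨ BranchLT r s t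

theorem tree_comparable [IsOrderTree T] {x y z : T} (hy : y ≤ x) (hz : z ≤ x) :
    y ≤ z ∨ z ≤ y := by
  rcases hy.lt_or_eq with hy | rfl
  · rcases hz.lt_or_eq with hz | rfl
    · rcases trichotomous_of (fun a b : Iio x => a < b) ⟨y, hy⟩ ⟨z, hz⟩ with h | h | h
      · exact Or.inl (le_of_lt h)
      · exact Or.inl (le_of_eq (congrArg Subtype.val h))
      · exact Or.inr (le_of_lt h)
    · exact Or.inl hy.le
  · exact Or.inr hz

theorem tree_cover_le [IsOrderTree T] {m a x z : T} (hma : m ⋖ a) (ha : a ≤ x) (hz : z ≤ x)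
    (h : m < z) : a ≤ z := by
  rcases tree_comparable ha hz with h' | h'
  · exact h'
  · rcases h'.lt_or_eq with h'' | rfl
    · exact absurd h'' (hma.2 h)
    · exact le_rfl

theorem tree_le_cover [IsOrderTree T] {m a x z : T} (hma : m ⋖ a) (ha : a ≤ x) (hz : z ≤ x)
    (h : ¬ a ≤ z) : z ≤ m := by
  rcases tree_comparable (hma.lt.le.trans ha) hz with h' | h'
  · rcases h'.lt_or_eq with h'' | rfl
    · exact absurd (tree_cover_le hma ha hz h'') h
    · exact le_rfl
  · exact h'

theorem tree_cover_unique [IsOrderTree T] {m a b x : T} (hma : m ⋖ a) (hmb : m ⋖ b) (ha : a ≤ x)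
    (hb : b ≤ x) : a = b :=
  le_antisymm (tree_cover_le hma ha hb hmb.lt) (tree_cover_le hmb hb ha hma.lt)

theorem branchLT_iff [IsOrderTree T] (r : T → T → Prop) [IsStrictTotalOrder T r] {s t : T} :
    BranchLT r s t ↔ ∃ m a b : T, m ⋖ a ∧ a ≤ s ∧ m ⋖ b ∧ b ≤ t ∧ r a b := by
  constructor
  · rintro ⟨-, -, m, a, b, -, h⟩
    exact ⟨m, a, b, h⟩
  · rintro ⟨m, a, b, hma, ha, hmb, hb, hr⟩
    have hne : a ≠ b := by
      rintro rfl
      exact irrefl_of r a hr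
    refine ⟨fun h => hne (tree_cover_unique hma hmb (ha.trans h) hb),
      fun h => hne (tree_cover_unique hma hmb ha (hb.trans h)), m, a, b,
      ⟨⟨hma.lt.trans_le ha, hmb.lt.trans_le hb⟩, ?_⟩, hma, ha, hmb, hb, hr⟩
    rintro y ⟨hys, hyt⟩
    refine tree_le_cover hma ha (le_of_lt hys) fun hay => ?_
    exact hne (tree_cover_unique hma hmb (hay.trans (le_of_lt hyt)) hb)

theorem branchLT_trans [IsOrderTree T] (r : T → T → Prop) [IsStrictTotalOrder T r] {s t v : T}
    (h₁ : BranchLT r s t) (h₂ : BranchLT r t v) : BranchLT r s v := by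
  rw [branchLT_iff] at *
  obtain ⟨m, a, b, hma, ha, hmb, hb, hr⟩ := h₁
  obtain ⟨m', a', b', hma', ha', hmb', hb', hr'⟩ := h₂
  by_cases h : m = m'
  · subst h
    obtain rfl := tree_cover_unique hmb hma' hb ha'
    exact ⟨m, a, b', hma, ha, hmb', hb', trans_of r hr hr'⟩
  · rcases tree_comparable (hmb.lt.le.trans hb) (hma'.lt.le.trans ha') with h' | h'
    · have hlt := lt_of_le_of_ne h' h
      exact ⟨m, a, b, hma, ha, hmb,
        (tree_cover_le hmb hb (hma'.lt.le.trans ha') hlt).trans (hmb'.lt.le.trans hb'), hr⟩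
    · have hlt := lt_of_le_of_ne h' (Ne.symm h)
      exact ⟨m', a', b', hma',
        (tree_cover_le hma' ha' (hmb.lt.le.trans hb) hlt).trans (hma.lt.le.trans ha),
        hmb', hb', hr'⟩

theorem lexLE_trans [IsOrderTree T] (r : T → T → Prop) [IsStrictTotalOrder T r] {s t v : T}
    (h₁ : LexLE r s t) (h₂ : LexLE r t v) : LexLE r s v := by
  rcases h₁ with h₁ | h₁ <;> rcases h₂ with h₂ | h₂
  · exact Or.inl (h₁.trans h₂)
  · obtain ⟨m, a, b, hma, ha, hmb, hb, hr⟩ := (branchLT_iff r).1 h₂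
    by_cases h : a ≤ s
    · exact Or.inr ((branchLT_iff r).2 ⟨m, a, b, hma, h, hmb, hb, hr⟩)
    · exact Or.inl ((tree_le_cover hma ha h₁ h).trans (hmb.lt.le.trans hb))
  · obtain ⟨m, a, b, hma, ha, hmb, hb, hr⟩ := (branchLT_iff r).1 h₁
    exact Or.inr ((branchLT_iff r).2 ⟨m, a, b, hma, ha, hmb, hb.trans h₂, hr⟩)
  · exact Or.inr (branchLT_trans r h₁ h₂)

theorem lexLE_antisymm [IsOrderTree T] (r : T → T → Prop) [IsStrictTotalOrder T r] {s t : T}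
    (h₁ : LexLE r s t) (h₂ : LexLE r t s) : s = t := by
  rcases h₁ with h₁ | h₁ <;> rcases h₂ with h₂ | h₂
  · exact le_antisymm h₁ h₂
  · exact absurd h₁ h₂.2.1
  · exact absurd h₂ h₁.2.1
  · exact absurd le_rfl (branchLT_trans r h₁ h₂).1

theorem nodeHeight_eq_typein [IsOrderTree T] {x : T} (y : Iio x) :
    nodeHeight y.1 = typein (fun a b : Iio x => a < b) y := by
  rw [nodeHeight, ← Ordinal.type_subrel]
  refine Ordinal.type_eq.2 ⟨⟨⟨fun z => ⟨⟨z.1, lt_trans z.2 y.2⟩, z.2⟩,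
    fun z => ⟨z.1.1, z.2⟩, fun _ => rfl, fun _ => rfl⟩, ?_⟩⟩
  intro a b
  exact Iff.rfl

theorem nodeHeight_lt [IsOrderTree T] {x y : T} (h : y < x) : nodeHeight y < nodeHeight x := by
  have := nodeHeight_eq_typein (⟨y, h⟩ : Iio x)
  change nodeHeight y = _ at this
  rw [this]
  exact typein_lt_type _ _

theorem exists_nodeHeight_eq [IsOrderTree T] {x : T} {β : Ordinal.{u}} (h : β < nodeHeight x) :
    ∃ y < x, nodeHeight y = β := by
  obtain ⟨y, hy⟩ := typein_surj (fun a b : Iio x => a < b) h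
  exact ⟨y.1, y.2, (nodeHeight_eq_typein y).trans hy⟩

theorem nodeHeight_lt_treeHeight [IsOrderTree T] (x : T) : nodeHeight x < treeHeight T := by
  have hne : {β | treeLevel T β = ∅}.Nonempty := by
    obtain ⟨b, hb⟩ := Ordinal.bddAbove_of_small (s := range fun x : T => nodeHeight x)
    refine ⟨Order.succ b, ?_⟩
    refine Set.eq_empty_of_forall_notMem fun y (hy : nodeHeight y = _) => ?_
    have : nodeHeight y ≤ b := hb ⟨y, rfl⟩
    rw [hy] at this
    exact absurd this (not_le.2 (Order.lt_succ b))
  have hmem : treeLevel T (treeHeight T) = ∅ := csInf_mem hne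
  by_contra hlt
  rcases (not_lt.1 hlt).lt_or_eq with h | h
  · obtain ⟨y, -, hy⟩ := exists_nodeHeight_eq h
    have : y ∈ treeLevel T (treeHeight T) := hy
    rw [hmem] at this
    exact this
  · have : x ∈ treeLevel T (treeHeight T) := h.symm
    rw [hmem] at this
    exact this

theorem nodeHeight_congr [IsOrderTree T] {a b : T} (h : Iio a = Iio b) :
    nodeHeight a = nodeHeight b := by
  refine Ordinal.type_eq.2 ⟨⟨Equiv.setCongr h, ?_⟩⟩
  intro x y
  exact Iff.rfl

theorem exists_min_not_le [IsOrderTree T] {s t : T} (h : ¬ s ≤ t) :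
    ∃ a ≤ s, ¬ a ≤ t ∧ ∀ y < a, y ≤ t := by
  by_cases hs : ∀ y < s, y ≤ t
  · exact ⟨s, le_rfl, h, hs⟩
  · push Not at hs
    obtain ⟨y, hys, hyt⟩ := hs
    obtain ⟨a, ha, hmin⟩ := (IsWellFounded.wf (r := fun a b : Iio s => a < b)).has_min
      {z | ¬ z.1 ≤ t} ⟨⟨y, hys⟩, hyt⟩
    refine ⟨a.1, le_of_lt a.2, ha, fun z hz => ?_⟩
    by_contra hzt
    exact hmin ⟨z, lt_trans hz a.2⟩ hzt hz

theorem exists_branch [IsOrderTree T] [IsNormalTree T] {s t : T} (hst : ¬ s ≤ t) (hts : ¬ t ≤ s) :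
    ∃ m a b : T, m ⋖ a ∧ a ≤ s ∧ m ⋖ b ∧ b ≤ t ∧ a ≠ b := by
  obtain ⟨a, has, hat, ha⟩ := exists_min_not_le hst
  obtain ⟨b, hbt, hbs, hb⟩ := exists_min_not_le hts
  have hab : a ≠ b := by
    rintro rfl
    exact hat hbt
  have hI : Iio a = Iio b := by
    ext y
    constructor
    · intro hy
      rcases tree_comparable (ha y hy) hbt with h | h
      · refine lt_of_le_of_ne h ?_
        rintro rfl
        exact hbs ((le_of_lt hy).trans has)
      · exact absurd (h.trans ((le_of_lt hy).trans has)) hbs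
    · intro hy
      rcases tree_comparable (hb y hy) has with h | h
      · refine lt_of_le_of_ne h ?_
        rintro rfl
        exact hat ((le_of_lt hy).trans hbt)
      · exact absurd (h.trans ((le_of_lt hy).trans hbt)) hat
  have hh := nodeHeight_congr hI
  rcases Ordinal.zero_or_succ_or_isSuccLimit (nodeHeight a) with h0 | ⟨o, ho⟩ | hl
  · exact absurd ((IsNormalTree.rooted (T := T)).unique h0 (hh.symm.trans h0)) hab
  · obtain ⟨m, hma, hm⟩ := exists_nodeHeight_eq (x := a) (β := o) (by rw [← ho]; simp)
    have hmax : ∀ y < a, ¬ m < y := fun y hy hmy => by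
      have h1 := nodeHeight_lt hmy
      have h2 := nodeHeight_lt hy
      rw [← ho] at h2
      rw [hm] at h1
      exact absurd h1 (not_lt.2 (Order.lt_succ_iff.1 (by simpa using h2)))
    have hmb : m < b := (hI ▸ hma : m ∈ Iio b)
    refine ⟨m, a, b, ⟨hma, fun y h1 h2 => hmax y h2 h1⟩, has,
      ⟨hmb, fun y h1 h2 => hmax y (hI.symm ▸ h2 : y ∈ Iio a) h1⟩, hbt, hab⟩
  · exact absurd (IsNormalTree.hausdorff _ (nodeHeight_lt_treeHeight a) hl a rfl b hh.symm hI) hab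

theorem lexLE_total [IsOrderTree T] [IsNormalTree T] (r : T → T → Prop) [IsStrictTotalOrder T r]
    (s t : T) : LexLE r s t ∨ LexLE r t s := by
  by_cases hst : s ≤ t
  · exact Or.inl (Or.inl hst)
  by_cases hts : t ≤ s
  · exact Or.inr (Or.inl hts)
  obtain ⟨m, a, b, hma, ha, hmb, hb, hne⟩ := exists_branch hst hts
  rcases trichotomous_of r a b with h | h | h
  · exact Or.inl (Or.inr ((branchLT_iff r).2 ⟨m, a, b, hma, ha, hmb, hb, h⟩))
  · exact absurd h hne
  · exact Or.inr (Or.inr ((branchLT_iff r).2 ⟨m, b, a, hmb, hb, hma, ha, h⟩))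

end Lex

/-- A copy of the tree `T`, to be equipped with the lexicographic order determined by the strict
total order `r` on `T` and with the corresponding order topology. -/
def LexLine (T : Type u) (_r : T → T → Prop) : Type u := T

noncomputable instance LexLine.instLinearOrder (T : Type u) [PartialOrder T] [IsOrderTree T]
    [IsNormalTree T] (r : T → T → Prop) [IsStrictTotalOrder T r] : LinearOrder (LexLine T r) where
  le s t := LexLE (T := T) r s t
  le_refl s := Or.inl (le_refl (α := T) s)
  le_trans _ _ _ h₁ h₂ := lexLE_trans (T := T) r h₁ h₂
  le_antisymm _ _ h₁ h₂ := lexLE_antisymm (T := T) r h₁ h₂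
  le_total s t := lexLE_total (T := T) r s t
  toDecidableLE := Classical.decRel _

/-- The order topology of the lexicographic order. -/
noncomputable instance LexLine.instTopologicalSpace (T : Type u) [PartialOrder T] [IsOrderTree T]
    [IsNormalTree T] (r : T → T → Prop) [IsStrictTotalOrder T r] :
    TopologicalSpace (LexLine T r) :=
  Preorder.topology (LexLine T r)

instance LexLine.instOrderTopology (T : Type u) [PartialOrder T] [IsOrderTree T]
    [IsNormalTree T] (r : T → T → Prop) [IsStrictTotalOrder T r] :
    OrderTopology (LexLine T r) :=
  ⟨rfl⟩

/-! ### Functional countability and exponential separability -/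

/-- Every continuous real-valued function has countable image. -/
def FunctionallyCountable (X : Type u) [TopologicalSpace X] : Prop :=
  ∀ f : X → ℝ, Continuous f → (range f).Countable

/-- `A` meets the intersection of every subfamily of `F` whose intersection is nonempty. -/
def StronglyDenseIn {X : Type u} (A : Set X) (F : Set (Set X)) : Prop :=
  ∀ G ⊆ F, (⋂₀ G).Nonempty → (A ∩ ⋂₀ G).Nonempty

/-- Every countable family of closed sets admits a countable strongly dense set. -/
def ExponentiallySeparable (X : Type u) [TopologicalSpace X] : Prop :=
  ∀ F : Set (Set X), F.Countable → (∀ C ∈ F, IsClosed C) →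
    ∃ A : Set X, A.Countable ∧ StronglyDenseIn A F

/-!
Let `F` be a countable family of closed subsets of the lexicographic line of a normal Souslin
tree. Two facts about nodes of large countable height make the proof work, and both come from the
Souslin property in the form `IsSouslinTree.exists_height_le_mem`: if every node has an extension
in `D`, then all nodes of height at least some `β < ω₁` already lie above a member of `D`.

* There is `α < ω₁` such that every node `p` of height at least `α` decides every `C ∈ F`: either
  `C` misses the cone above `p`, or `C` is cofinal in that cone (`decidingNodes`).
* There is `δ > α`, `δ < ω₁`, such that below every node `z` of height `δ` there are, at cofinally
  many heights, nodes with an `r`-smaller sibling (`exists_height_cofinal_rightTurns`).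

If `z` has height `δ` and lies above a node of height `α` above which `C` is cofinal, then the cones
of those `r`-smaller siblings contain points of `C` that converge to `z` from the left, so `z ∈ C`
(`mem_of_isClosed_of_cofinal_above`). Now let `x` have height above `δ` and let `z` be
its predecessor of height `δ`. Each `C ∈ F` containing `x` meets the cone of every predecessor of
`x`, hence is cofinal above the one of height `α`, hence contains `z`. Thus the countable set of
nodes of height at most `δ` is strongly dense in `F`.

Functional countability follows by applying exponential separability to the preimages of the closed
intervals with rational endpoints.
-/

/-! ### Exponential separability implies functional countability -/

theorem ExponentiallySeparable.functionallyCountable {X : Type u} [TopologicalSpace X]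
    (hX : ExponentiallySeparable X) : FunctionallyCountable X := by
  intro f hf
  obtain ⟨A, hA, hAF⟩ := hX (range fun p : ℚ × ℚ => f ⁻¹' Icc (p.1 : ℝ) p.2)
    (countable_range _) (by
      rintro _ ⟨p, rfl⟩
      exact isClosed_Icc.preimage hf)
  refine (hA.image f).mono ?_
  rintro _ ⟨x, rfl⟩
  obtain ⟨a, haA, ha⟩ := hAF
    {C | ∃ p : ℚ × ℚ, ((p.1 : ℝ) ≤ f x ∧ f x ≤ p.2) ∧ f ⁻¹' Icc (p.1 : ℝ) p.2 = C}
    (by rintro _ ⟨p, -, rfl⟩; exact ⟨p, rfl⟩)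
    ⟨x, by rintro _ ⟨p, hp, rfl⟩; exact hp⟩
  refine ⟨a, haA, ?_⟩
  -- A rational strictly between `f a` and `f x` bounds an interval separating them.
  rcases lt_trichotomy (f a) (f x) with h | h | h
  · obtain ⟨p, hp, hp'⟩ := exists_rat_btwn h
    obtain ⟨q, hq⟩ := exists_rat_gt (f x)
    have : f a ∈ Icc (p : ℝ) q := ha _ ⟨(p, q), ⟨hp'.le, hq.le⟩, rfl⟩
    exact absurd this.1 (not_le.2 hp)
  · exact h
  · obtain ⟨p, hp, hp'⟩ := exists_rat_btwn h
    obtain ⟨q, hq⟩ := exists_rat_lt (f x)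
    have : f a ∈ Icc (q : ℝ) p := ha _ ⟨(q, p), ⟨hq.le, hp.le⟩, rfl⟩
    exact absurd this.2 (not_le.2 hp')

/-! ### Heights in trees -/

section Heights

variable {T : Type u} [PartialOrder T] [IsOrderTree T]

theorem nodeHeight_mono {x y : T} (h : x ≤ y) : nodeHeight x ≤ nodeHeight y := by
  rcases h.lt_or_eq with h | rfl
  · exact (nodeHeight_lt h).le
  · exact le_rfl

theorem le_of_nodeHeight_le {x y z : T} (hx : x ≤ z) (hy : y ≤ z)
    (h : nodeHeight x ≤ nodeHeight y) : x ≤ y := by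
  rcases tree_comparable hx hy with h' | h'
  · exact h'
  · rcases h'.lt_or_eq with h'' | rfl
    · exact absurd h (not_le.2 (nodeHeight_lt h''))
    · exact le_rfl

theorem lt_of_nodeHeight_lt {x y z : T} (hx : x ≤ z) (hy : y ≤ z)
    (h : nodeHeight x < nodeHeight y) : x < y :=
  (le_of_nodeHeight_le hx hy h.le).lt_of_ne (by rintro rfl; exact lt_irrefl _ h)

theorem exists_le_nodeHeight_eq {x : T} {β : Ordinal.{u}} (h : β ≤ nodeHeight x) :
    ∃ y ≤ x, nodeHeight y = β := by
  rcases h.lt_or_eq with h | rfl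
  · obtain ⟨y, hy, hyβ⟩ := exists_nodeHeight_eq h
    exact ⟨y, hy.le, hyβ⟩
  · exact ⟨x, le_rfl, rfl⟩

theorem covBy_of_nodeHeight_eq_succ {x y : T} (h : x < y)
    (hxy : nodeHeight y = nodeHeight x + 1) : x ⋖ y := by
  refine ⟨h, fun z hxz hzy => ?_⟩
  have h1 := nodeHeight_lt hxz
  have h2 := nodeHeight_lt hzy
  rw [hxy] at h2
  exact absurd h1 (not_lt.2 (Order.lt_add_one_iff.1 h2))

theorem exists_minimal_le_mem {D : Set T} {d : T} (hd : d ∈ D) :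
    ∃ w ≤ d, Minimal (· ∈ D) w := by
  obtain ⟨w, ⟨hwD, hwd⟩, hmin⟩ := (InvImage.wf (nodeHeight (T := T)) Ordinal.lt_wf).has_min
    {w | w ∈ D ∧ w ≤ d} ⟨d, hd, le_rfl⟩
  refine ⟨w, hwd, hwD, fun y hy hyw => ?_⟩
  by_contra hwy
  exact hmin y ⟨hy, hyw.trans hwd⟩ (nodeHeight_lt (lt_of_le_not_ge hyw hwy))

end Heights

section Souslin

variable {T : Type u} [PartialOrder T] [IsOrderTree T]

theorem IsSouslinTree.nodeHeight_lt_omega_one (hT : IsSouslinTree T) (x : T) :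
    nodeHeight x < ω₁ :=
  hT.height_eq ▸ nodeHeight_lt_treeHeight x

theorem IsSouslinTree.exists_le_nodeHeight_eq [IsNormalTree T] (hT : IsSouslinTree T) {x : T}
    {β : Ordinal.{u}} (hβ : β < ω₁) (h : nodeHeight x ≤ β) : ∃ y, x ≤ y ∧ nodeHeight y = β := by
  rcases h.lt_or_eq with h | h
  · obtain ⟨y, hy, hxy⟩ := IsNormalTree.pruned _ β h (hT.height_eq.symm ▸ hβ) x rfl
    exact ⟨y, hxy.le, hy⟩
  · exact ⟨x, le_rfl, h⟩

/-- A cofinal set of nodes is already met below some countable height. The minimal elements of `D`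
form an antichain, hence have bounded heights, and every node beyond the bound has an extension
in `D`, whose minimal predecessor in `D` lies below the node. -/
theorem IsSouslinTree.exists_height_le_mem (hT : IsSouslinTree T) {D : Set T}
    (hD : ∀ x, ∃ y ∈ D, x ≤ y) :
    ∃ β < ω₁, ∀ x : T, β ≤ nodeHeight x → ∃ d ∈ D, d ≤ x := by
  have hW : {w | Minimal (· ∈ D) w}.Countable :=
    hT.countable_antichain _ (setOfPred_minimal_antichain (· ∈ D))
  have : Countable {w | Minimal (· ∈ D) w} := hW.to_subtype
  refine ⟨⨆ w : {w | Minimal (· ∈ D) w}, nodeHeight w.1,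
    Ordinal.iSup_lt_omega_one fun w => hT.nodeHeight_lt_omega_one w.1, fun x hx => ?_⟩
  obtain ⟨d, hd, hxd⟩ := hD x
  obtain ⟨w, hwd, hw⟩ := exists_minimal_le_mem hd
  exact ⟨w, hw.1, le_of_nodeHeight_le hwd hxd
    ((Ordinal.le_iSup (fun w : {w | Minimal (· ∈ D) w} => nodeHeight w.1) ⟨w, hw⟩).trans hx)⟩

theorem IsSouslinTree.countable_setOf_nodeHeight_le [IsNormalTree T] (hT : IsSouslinTree T)
    {β : Ordinal.{u}} (hβ : β < ω₁) : {x : T | nodeHeight x ≤ β}.Countable := by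
  refine ((hT.countable_level β).biUnion fun z _ => hT.countable_chain (Iic z) ?_).mono ?_
  · exact fun x hx y hy _ => tree_comparable hx hy
  · intro x hx
    obtain ⟨y, hxy, hy⟩ := hT.exists_le_nodeHeight_eq hβ hx
    exact mem_biUnion hy hxy

/-! ### Deciding nodes and right turns -/

/-- The nodes that decide `C`: the set `C` either misses the cone above the node or is cofinal in
that cone, with respect to the tree order. -/
def decidingNodes {T : Type u} [PartialOrder T] (C : Set T) : Set T :=
  {p | (∀ y, p ≤ y → y ∉ C) ∨ ∀ q, p ≤ q → ∃ y ∈ C, q ≤ y}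

theorem exists_le_mem_decidingNodes {T : Type u} [PartialOrder T] (C : Set T) (x : T) :
    ∃ y ∈ decidingNodes C, x ≤ y := by
  by_cases h : ∀ q, x ≤ q → ∃ y ∈ C, q ≤ y
  · exact ⟨x, Or.inr h, le_rfl⟩
  · push Not at h
    obtain ⟨q, hxq, hq⟩ := h
    exact ⟨q, Or.inl fun y hqy hy => hq y hy hqy, hxq⟩

/-- A right turn is a node with an `r`-smaller sibling. -/
def rightTurns {T : Type u} [PartialOrder T] (r : T → T → Prop) : Set T :=
  {b | ∃ m a, m ⋖ a ∧ m ⋖ b ∧ r a b}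

theorem IsSouslinTree.exists_rightTurn [IsNormalTree T] (hT : IsSouslinTree T) (r : T → T → Prop)
    [IsStrictTotalOrder T r] {γ : Ordinal.{u}} (hγ : γ < ω₁) (x : T) :
    ∃ b ∈ {b ∈ rightTurns r | γ < nodeHeight b}, x ≤ b := by
  have hlim : ∀ β < (ω₁ : Ordinal.{u}), β + 1 < ω₁ := fun β hβ =>
    (Cardinal.isSuccLimit_omega 1).add_one_lt hβ
  obtain ⟨m, hxm, hm⟩ := hT.exists_le_nodeHeight_eq (x := x)
    (max_lt (hT.nodeHeight_lt_omega_one x) hγ) (le_max_left _ _)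
  obtain ⟨y₀, h₀, y₁, h₁, hm₀, hm₁, hne⟩ := IsNormalTree.splitting (nodeHeight m)
    (hT.height_eq.symm ▸ hlim _ (hT.nodeHeight_lt_omega_one m)) m rfl
  have hγm : γ ≤ nodeHeight m := hm ▸ le_max_right _ _
  have c₀ := covBy_of_nodeHeight_eq_succ hm₀ h₀
  have c₁ := covBy_of_nodeHeight_eq_succ hm₁ h₁
  rcases trichotomous_of r y₀ y₁ with h | h | h
  · exact ⟨y₁, ⟨⟨m, y₀, c₀, c₁, h⟩, hγm.trans_lt (nodeHeight_lt hm₁)⟩, hxm.trans hm₁.le⟩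
  · exact absurd h hne
  · exact ⟨y₀, ⟨⟨m, y₁, c₁, c₀, h⟩, hγm.trans_lt (nodeHeight_lt hm₀)⟩, hxm.trans hm₀.le⟩

/-- Beyond every countable height there is a countable height `δ` such that the right turns below
every node of height `δ` have heights cofinal in `δ`. Here `δ` is the supremum of a sequence of
heights between any two consecutive terms of which every long enough branch makes a right turn. -/
theorem IsSouslinTree.exists_height_cofinal_rightTurns [IsNormalTree T] (hT : IsSouslinTree T)
    (r : T → T → Prop) [IsStrictTotalOrder T r] {α : Ordinal.{u}} (hα : α < ω₁) :
    ∃ δ, α < δ ∧ δ < ω₁ ∧ ∀ z : T, nodeHeight z = δ → ∀ γ < δ,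
      ∃ b ∈ rightTurns r, b < z ∧ γ < nodeHeight b := by
  have step : ∀ γ : Iio (ω₁ : Ordinal.{u}), ∃ β : Iio (ω₁ : Ordinal.{u}), γ < β ∧
      ∀ x : T, β.1 ≤ nodeHeight x → ∃ b ∈ {b ∈ rightTurns r | γ.1 < nodeHeight b}, b ≤ x := by
    intro γ
    obtain ⟨β, hβ, h⟩ := hT.exists_height_le_mem (hT.exists_rightTurn r γ.2)
    refine ⟨⟨max β (γ.1 + 1), max_lt hβ ((Cardinal.isSuccLimit_omega 1).add_one_lt γ.2)⟩, ?_,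
      fun x hx => h x ((le_max_left _ _).trans hx)⟩
    exact (lt_add_one γ.1).trans_le (le_max_right β (γ.1 + 1))
  choose B hB hBR using step
  let s : ℕ → Iio (ω₁ : Ordinal.{u}) := fun k => B^[k] ⟨α, hα⟩
  have hs : ∀ k, s (k + 1) = B (s k) := fun k => Function.iterate_succ_apply' B k _
  have hlt : ∀ k, (s k).1 < ⨆ i, (s i).1 := fun k => by
    have h : (s k).1 < (s (k + 1)).1 := by
      rw [hs]
      exact hB (s k)
    exact h.trans_le (Ordinal.le_iSup (fun i => (s i).1) (k + 1))
  refine ⟨⨆ i, (s i).1, hlt 0, Ordinal.iSup_lt_omega_one fun i => (s i).2, fun z hz γ hγ => ?_⟩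
  obtain ⟨k, hk⟩ := Ordinal.lt_iSup_iff.1 hγ
  obtain ⟨y, hyz, hy⟩ := exists_nodeHeight_eq (hz.symm ▸ hlt (k + 1))
  obtain ⟨b, ⟨hb, hkb⟩, hby⟩ := hBR (s k) y (by rw [hy, hs])
  exact ⟨b, hb, hby.trans_lt hyz, hk.trans hkb⟩

/-! ### Exponential separability of the lexicographic line -/

/-- If a closed set `C` of the lexicographic line is cofinal above some predecessor `p` of a node
`z` that is a limit of right turns, then `z ∈ C`. -/
theorem mem_of_isClosed_of_cofinal_above [IsNormalTree T] (r : T → T → Prop)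
    [IsStrictTotalOrder T r] {C : Set (LexLine T r)} (hC : IsClosed C) {p z : T} (hpz : p < z)
    (hz : ∀ γ < nodeHeight z, ∃ b ∈ rightTurns r, b < z ∧ γ < nodeHeight b)
    (hp : ∀ q : T, p ≤ q → ∃ y : T, y ∈ C ∧ q ≤ y) : z ∈ C := by
  -- Below a node `c < z` there is no obstruction: `C` has a point above `c` and to the left of `z`.
  have key : ∀ c < z, ∃ y : T, y ∈ C ∧ c < y ∧ BranchLT r y z := by
    intro c hc
    obtain ⟨b, ⟨m, a, hma, hmb, hab⟩, hbz, hb⟩ :=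
      hz _ (max_lt (nodeHeight_lt hc) (nodeHeight_lt hpz))
    have hcm : c ≤ m := tree_le_cover hmb hbz.le hc.le fun h =>
      absurd ((le_max_left _ _).trans_lt hb) (not_lt.2 (nodeHeight_mono h))
    have hpm : p ≤ m := tree_le_cover hmb hbz.le hpz.le fun h =>
      absurd ((le_max_right _ _).trans_lt hb) (not_lt.2 (nodeHeight_mono h))
    obtain ⟨y, hyC, hay⟩ := hp a (hpm.trans hma.lt.le)
    exact ⟨y, hyC, hcm.trans_lt (hma.lt.trans_le hay),
      (branchLT_iff r).2 ⟨m, a, b, hma, hay, hmb, hbz.le, hab⟩⟩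
  let e : T → LexLine T r := fun t => t
  change e z ∈ C
  have hlex : ∀ {s t : T}, LexLE r s t → s ≠ t → e s < e t := fun h hne =>
    lt_of_le_of_ne (α := LexLine T r) h hne
  rw [← hC.closure_eq]
  refine mem_closure_iff_nhds.2 fun U hU => ?_
  obtain ⟨l, hlz, hl⟩ := exists_Ioc_subset_of_mem_nhds hU ⟨e p, hlex (Or.inl hpz.le) hpz.ne⟩
  suffices ∃ y : T, y ∈ C ∧ l < e y ∧ BranchLT r y z by
    obtain ⟨y, hyC, hly, hyz⟩ := this
    exact ⟨e y, hl ⟨hly, (Or.inr hyz : LexLE r y z)⟩, hyC⟩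
  have hle : LexLE (T := T) r l z := hlz.le
  rcases hle with h | h
  · obtain ⟨y, hyC, hly, hyz⟩ := key l (lt_of_le_of_ne h hlz.ne)
    exact ⟨y, hyC, hlex (Or.inl hly.le) hly.ne, hyz⟩
  · obtain ⟨m, a, b, hma, hal, hmb, hbz, hab⟩ := (branchLT_iff r).1 h
    -- The branching at `m` happens strictly below `z`, which covers no node.
    have hbz' : b < z := by
      refine lt_of_le_of_ne hbz ?_
      rintro rfl
      obtain ⟨b', -, hb', hmb'⟩ := hz _ (nodeHeight_lt hmb.lt)
      exact hmb.2 (lt_of_nodeHeight_lt hmb.lt.le hb'.le hmb') hb'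
    obtain ⟨y, hyC, hby, hyz⟩ := key b hbz'
    have hly : BranchLT (T := T) r l y := (branchLT_iff r).2 ⟨m, a, b, hma, hal, hmb, hby.le, hab⟩
    exact ⟨y, hyC, hlex (Or.inr hly) fun h => hly.1 (le_of_eq h), hyz⟩

theorem IsSouslinTree.exponentiallySeparable_lexLine [IsNormalTree T] (hT : IsSouslinTree T)
    (r : T → T → Prop) [IsStrictTotalOrder T r] : ExponentiallySeparable (LexLine T r) := by
  intro F hF hFc
  have : Countable F := hF.to_subtype
  choose β hβ hdec using fun C : F =>
    hT.exists_height_le_mem (exists_le_mem_decidingNodes (T := T) C.1)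
  obtain ⟨δ, hαδ, hδ, hturn⟩ := hT.exists_height_cofinal_rightTurns r
    (α := ⨆ C, β C) (Ordinal.iSup_lt_omega_one hβ)
  refine ⟨{x : T | nodeHeight x ≤ δ}, hT.countable_setOf_nodeHeight_le hδ, ?_⟩
  rintro G hG ⟨x, hx⟩
  change T at x
  rcases le_or_gt (nodeHeight x) δ with h | h
  · exact ⟨x, h, hx⟩
  obtain ⟨z, hzx, hz⟩ := exists_nodeHeight_eq h
  refine ⟨z, hz.le, fun C hC => ?_⟩
  obtain ⟨p, hpz, hp⟩ := exists_nodeHeight_eq (hz.symm ▸ hαδ)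
  obtain ⟨d, hd, hdp⟩ := hdec ⟨C, hG hC⟩ p (hp.symm ▸ Ordinal.le_iSup β ⟨C, hG hC⟩)
  rcases hd with hd | hd
  · exact absurd (hx C hC) (hd x (hdp.trans (hpz.trans hzx).le))
  · exact mem_of_isClosed_of_cofinal_above r (hFc C (hG hC)) hpz
      (fun γ hγ => hturn z hz γ (hz ▸ hγ)) fun q hq => hd q (hdp.trans hq)

end Souslin

theorem mainTheorem1 (T : Type u) [PartialOrder T] [IsOrderTree T] [IsNormalTree T]
    (hT : IsSouslinTree T) (r : T → T → Prop) [IsStrictTotalOrder T r] :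
    FunctionallyCountable (LexLine T r) ∧ ExponentiallySeparable (LexLine T r) :=
  ⟨(hT.exponentiallySeparable_lexLine r).functionallyCountable,
    hT.exponentiallySeparable_lexLine r⟩
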